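/- Manifolds are smooth ($C^\infty$), finite-dimensional, without boundary and second countable. A groupoid with set of arrows $G$ and set of objects $G_0$ has source and target maps $\alpha,\beta:G\to G_0$, and $b\circ a$ is defined when $\alpha(b)=\beta(a)$. It is a Lie groupoid if $G$ and $G_0$ are manifolds, $G_0$ and the fibres of $\alpha$ are Hausdorff, $\alpha$ and $\beta$ are surjective submersions, and composition (on $\{(b,a)\in G\times G:\alpha(b)=\beta(a)\}$), the unit map $G_0\to G$ and the groupoid inversion are smooth. A morphism of Lie groupoids is a groupoid morphism that is smooth on arrows and on objects. A Lie group-groupoid is a Lie groupoid $G$ over a group $G_0$ together with a (Hausdorff) Lie group structure on $G$ such that the multiplication $G\times G\to G$, the unit $*\to G$ (whose value is the identity arrow $1_e$ at the unit $e$ of $G_0$) and the group inversion $G\to G$ are morphisms of Lie groupoids, given on objects by the corresponding operations of $G_0$, and such that the interchange law $(b\circ a)(d\circ c)=(bd)\circ(ac)$ holds whenever $b\circ a$ and $d\circ c$ are defined. Proposition. Let $M$ be a connected Lie group (real, finite-dimensional, Hausdorff, second countable). Let $\pi_1M$ be its fundamental groupoid, with object set $M$ and with the homotopy classes rel end points of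 paths in $M$ as arrows. Give the set of arrows the lifted topology, in which the class $a$ of a path from $x$ to $y$ has as basic neighbourhoods the sets of all classes obtained from $a$ by precomposing with the reverse of a path starting at $x$ in a neighbourhood $U$ of $x$ and postcomposing with a path starting at $y$ in a neighbourhood $V$ of $y$. Then there is a smooth manifold structure on the set of arrows, inducing the lifted topology, such that the end-point map $(\beta,\alpha):\pi_1M\to M\times M$ is a covering map and a local diffeomorphism, and such that, with the operation $[a][b]=[t\mapsto a(t)b(t)]$ induced by the multiplication of $M$, $\pi_1M$ is a Lie group-groupoid over the group $M$. -/

import Mathlib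

open scoped Manifold ContDiff Topology

/-- A groupoid with set of arrows `G` and set of objects `G₀`, in the two-set presentation:
`comp b a h` is `b ∘ a`, defined when the source of `b` is the target of `a`. -/
structure GroupoidOver (G G₀ : Type*) where
  src : G → G₀
  tgt : G → G₀
  unit : G₀ → G
  inverse : G → G
  comp : (b a : G) → src b = tgt a → G
  src_comp : ∀ (b a : G) (h : src b = tgt a), src (comp b a h) = src a
  tgt_comp : ∀ (b a : G) (h : src b = tgt a), tgt (comp b a h) = tgt b
  comp_assoc : ∀ (c b a : G) (h₁ : src b = tgt a) (h₂ : src c = tgt b),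
    comp c (comp b a h₁) (h₂.trans (tgt_comp b a h₁).symm) =
      comp (comp c b h₂) a ((src_comp c b h₂).trans h₁)
  src_unit : ∀ x : G₀, src (unit x) = x
  tgt_unit : ∀ x : G₀, tgt (unit x) = x
  comp_unit : ∀ a : G, comp a (unit (src a)) (tgt_unit (src a)).symm = a
  unit_comp : ∀ a : G, comp (unit (tgt a)) a (src_unit (tgt a)) = a
  src_inverse : ∀ a : G, src (inverse a) = tgt a
  tgt_inverse : ∀ a : G, tgt (inverse a) = src a
  inverse_comp : ∀ a : G, comp (inverse a) a (src_inverse a) = unit (src a)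
  comp_inverse : ∀ a : G, comp a (inverse a) (tgt_inverse a).symm = unit (tgt a)

namespace GroupoidOver

/-- The pullback `{(b, a) | src b = tgt a}` of composable pairs. -/
def composable {G G₀ : Type*} (𝓖 : GroupoidOver G G₀) : Set (G × G) :=
  {p | 𝓖.src p.1 = 𝓖.tgt p.2}

open Classical in
/-- The composition map extended by a dummy value outside `𝓖.composable`; it is only ever used on
that set. -/
noncomputable def compMap {G G₀ : Type*} (𝓖 : GroupoidOver G G₀) (p : G × G) : G :=
  if h : 𝓖.src p.1 = 𝓖.tgt p.2 then 𝓖.comp p.1 p.2 h else p.1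

/-- The product of two groupoids, with all structure maps defined componentwise. -/
def prod {G G₀ H H₀ : Type*} (𝓖 : GroupoidOver G G₀) (𝓗 : GroupoidOver H H₀) :
    GroupoidOver (G × H) (G₀ × H₀) where
  src p := (𝓖.src p.1, 𝓗.src p.2)
  tgt p := (𝓖.tgt p.1, 𝓗.tgt p.2)
  unit x := (𝓖.unit x.1, 𝓗.unit x.2)
  inverse p := (𝓖.inverse p.1, 𝓗.inverse p.2)
  comp q p h := (𝓖.comp q.1 p.1 (congrArg Prod.fst h), 𝓗.comp q.2 p.2 (congrArg Prod.snd h))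
  src_comp _ _ _ := Prod.ext (𝓖.src_comp _ _ _) (𝓗.src_comp _ _ _)
  tgt_comp _ _ _ := Prod.ext (𝓖.tgt_comp _ _ _) (𝓗.tgt_comp _ _ _)
  comp_assoc _ _ _ _ _ := Prod.ext (𝓖.comp_assoc _ _ _ _ _) (𝓗.comp_assoc _ _ _ _ _)
  src_unit _ := Prod.ext (𝓖.src_unit _) (𝓗.src_unit _)
  tgt_unit _ := Prod.ext (𝓖.tgt_unit _) (𝓗.tgt_unit _)
  comp_unit _ := Prod.ext (𝓖.comp_unit _) (𝓗.comp_unit _)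
  unit_comp _ := Prod.ext (𝓖.unit_comp _) (𝓗.unit_comp _)
  src_inverse _ := Prod.ext (𝓖.src_inverse _) (𝓗.src_inverse _)
  tgt_inverse _ := Prod.ext (𝓖.tgt_inverse _) (𝓗.tgt_inverse _)
  inverse_comp _ := Prod.ext (𝓖.inverse_comp _) (𝓗.inverse_comp _)
  comp_inverse _ := Prod.ext (𝓖.comp_inverse _) (𝓗.comp_inverse _)

/-- The groupoid with one object and one arrow. -/
def point : GroupoidOver PUnit.{1} PUnit.{1} where
  src := id
  tgt := id
  unit := id
  inverse := id
  comp _ _ _ := PUnit.unit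
  src_comp _ _ _ := rfl
  tgt_comp _ _ _ := rfl
  comp_assoc _ _ _ _ _ := rfl
  src_unit _ := rfl
  tgt_unit _ := rfl
  comp_unit _ := rfl
  unit_comp _ := rfl
  src_inverse _ := rfl
  tgt_inverse _ := rfl
  inverse_comp _ := rfl
  comp_inverse _ := rfl

end GroupoidOver

/-- A finite-dimensional, second countable smooth manifold without boundary. -/
structure IsSmoothManifold {E H : Type*} [NormedAddCommGroup E] [NormedSpace ℝ E]
    [TopologicalSpace H] (I : ModelWithCorners ℝ E H) (X : Type*) [TopologicalSpace X]
    [ChartedSpace H X] : Prop where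
  finiteDimensional : FiniteDimensional ℝ E
  boundaryless : I.Boundaryless
  isManifold : IsManifold I ∞ X
  secondCountable : SecondCountableTopology X

/-- A Lie groupoid: arrows and objects form smooth manifolds, the objects and the source fibres are
Hausdorff, source and target are surjective submersions and the structure maps are smooth.
The set of composable pairs is a closed submanifold of `G × G`, and a map is smooth on it if and
only if it is smooth on it as a subset of `G × G`, which is what `contMDiffOn_comp` says. -/
structure IsLieGroupoid {E H E₀ H₀ : Type*} [NormedAddCommGroup E] [NormedSpace ℝ E]
    [TopologicalSpace H] [NormedAddCommGroup E₀] [NormedSpace ℝ E₀] [TopologicalSpace H₀]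
    (I : ModelWithCorners ℝ E H) (I₀ : ModelWithCorners ℝ E₀ H₀)
    {G G₀ : Type*} [TopologicalSpace G] [ChartedSpace H G] [TopologicalSpace G₀]
    [ChartedSpace H₀ G₀] (𝓖 : GroupoidOver G G₀) : Prop where
  manifold : IsSmoothManifold I G
  manifold₀ : IsSmoothManifold I₀ G₀
  t2₀ : T2Space G₀
  t2_fibre : ∀ x : G₀, T2Space {a : G // 𝓖.src a = x}
  src_surjective : Function.Surjective 𝓖.src
  tgt_surjective : Function.Surjective 𝓖.tgt
  src_submersion : Manifold.IsSubmersion I I₀ ∞ 𝓖.src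
  tgt_submersion : Manifold.IsSubmersion I I₀ ∞ 𝓖.tgt
  contMDiffOn_comp : ContMDiffOn (I.prod I) I ∞ 𝓖.compMap 𝓖.composable
  contMDiff_unit : ContMDiff I₀ I ∞ 𝓖.unit
  contMDiff_inverse : ContMDiff I I ∞ 𝓖.inverse

/-- `(f, f₀)` is a morphism of Lie groupoids: a groupoid morphism with `f` and `f₀` smooth. -/
structure IsLieGroupoidMorphism {E H E₀ H₀ E' H' E₀' H₀' : Type*}
    [NormedAddCommGroup E] [NormedSpace ℝ E] [TopologicalSpace H]
    [NormedAddCommGroup E₀] [NormedSpace ℝ E₀] [TopologicalSpace H₀]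
    [NormedAddCommGroup E'] [NormedSpace ℝ E'] [TopologicalSpace H']
    [NormedAddCommGroup E₀'] [NormedSpace ℝ E₀'] [TopologicalSpace H₀']
    (I : ModelWithCorners ℝ E H) (I₀ : ModelWithCorners ℝ E₀ H₀)
    (I' : ModelWithCorners ℝ E' H') (I₀' : ModelWithCorners ℝ E₀' H₀')
    {G G₀ G' G₀' : Type*} [TopologicalSpace G] [ChartedSpace H G]
    [TopologicalSpace G₀] [ChartedSpace H₀ G₀] [TopologicalSpace G'] [ChartedSpace H' G']
    [TopologicalSpace G₀'] [ChartedSpace H₀' G₀']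
    (𝓖 : GroupoidOver G G₀) (𝓖' : GroupoidOver G' G₀') (f : G → G') (f₀ : G₀ → G₀') : Prop where
  src_map : ∀ a : G, 𝓖'.src (f a) = f₀ (𝓖.src a)
  tgt_map : ∀ a : G, 𝓖'.tgt (f a) = f₀ (𝓖.tgt a)
  map_comp : ∀ (b a : G) (h : 𝓖.src b = 𝓖.tgt a),
    f (𝓖.comp b a h) = 𝓖'.comp (f b) (f a) (by rw [src_map, tgt_map, h])
  contMDiff : ContMDiff I I' ∞ f
  contMDiff₀ : ContMDiff I₀ I₀' ∞ f₀

/-- A Lie group-groupoid: a Lie groupoid whose arrows form a Lie group (written multiplicatively)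
such that multiplication, unit and inversion are morphisms of Lie groupoids, and the interchange
law holds. On objects these morphisms are the operations of the group `G₀`. -/
structure IsLieGroupGroupoid {E H E₀ H₀ : Type*} [NormedAddCommGroup E] [NormedSpace ℝ E]
    [TopologicalSpace H] [NormedAddCommGroup E₀] [NormedSpace ℝ E₀] [TopologicalSpace H₀]
    (I : ModelWithCorners ℝ E H) (I₀ : ModelWithCorners ℝ E₀ H₀)
    {G G₀ : Type*} [TopologicalSpace G] [ChartedSpace H G] [TopologicalSpace G₀]
    [ChartedSpace H₀ G₀] [Group G] [Group G₀] (𝓖 : GroupoidOver G G₀) : Prop where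
  isLieGroupoid : IsLieGroupoid I I₀ 𝓖
  t2 : T2Space G
  lieGroup : LieGroup I ∞ G
  mul_morphism : IsLieGroupoidMorphism (I.prod I) (I₀.prod I₀) I I₀ (𝓖.prod 𝓖) 𝓖
    (fun p => p.1 * p.2) (fun x => x.1 * x.2)
  one_morphism : IsLieGroupoidMorphism 𝓘(ℝ, PUnit.{1}) 𝓘(ℝ, PUnit.{1}) I I₀ GroupoidOver.point 𝓖
    (fun _ => 1) (fun _ => 1)
  inv_morphism : IsLieGroupoidMorphism I I₀ I I₀ 𝓖 𝓖 (fun a => a⁻¹) (fun x => x⁻¹)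
  one_eq_unit : (1 : G) = 𝓖.unit 1
  interchange : ∀ (a b c d : G) (h₁ : 𝓖.src b = 𝓖.tgt a) (h₂ : 𝓖.src d = 𝓖.tgt c)
    (h : 𝓖.src (b * d) = 𝓖.tgt (a * c)),
    𝓖.comp b a h₁ * 𝓖.comp d c h₂ = 𝓖.comp (b * d) (a * c) h

/-- The set of arrows of the fundamental groupoid of `X`: homotopy classes, relative to the end
points, of paths in `X`. -/
structure PathClass (X : Type*) [TopologicalSpace X] where
  source : X
  target : X
  hom : Path.Homotopic.Quotient source target

namespace PathClass

/-- The lifted topology: basic neighbourhoods of the class `a` of a path from `x` to `y` consist of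
the classes `u⁻¹ a v`, where `u` is a path from `x` in a neighbourhood `U` of `x` and `v` is a path
from `y` in a neighbourhood `V` of `y`. -/
noncomputable instance liftedTopology (X : Type*) [TopologicalSpace X] : TopologicalSpace (PathClass X) where
  IsOpen W := ∀ a ∈ W, ∃ U ∈ 𝓝 a.source, ∃ V ∈ 𝓝 a.target,
    ∀ (x y : X) (u : Path a.source x) (v : Path a.target y),
      Set.range u ⊆ U → Set.range v ⊆ V →
        (⟨x, y, (Path.Homotopic.Quotient.mk u).symm.trans
          (a.hom.trans (Path.Homotopic.Quotient.mk v))⟩ : PathClass X) ∈ W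
  isOpen_univ := fun _ _ =>
    ⟨Set.univ, Filter.univ_mem, Set.univ, Filter.univ_mem, fun _ _ _ _ _ _ => trivial⟩
  isOpen_inter := fun _ _ h₁ h₂ a ha => by
    obtain ⟨U₁, hU₁, V₁, hV₁, H₁⟩ := h₁ a ha.1
    obtain ⟨U₂, hU₂, V₂, hV₂, H₂⟩ := h₂ a ha.2
    exact ⟨U₁ ∩ U₂, Filter.inter_mem hU₁ hU₂, V₁ ∩ V₂, Filter.inter_mem hV₁ hV₂,
      fun x y u v hu hv =>
        ⟨H₁ x y u v (hu.trans Set.inter_subset_left) (hv.trans Set.inter_subset_left),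
          H₂ x y u v (hu.trans Set.inter_subset_right) (hv.trans Set.inter_subset_right)⟩⟩
  isOpen_sUnion := fun _ h a ⟨s, hs, ha⟩ => by
    obtain ⟨U, hU, V, hV, H⟩ := h s hs a ha
    exact ⟨U, hU, V, hV, fun x y u v hu hv => ⟨s, hs, H x y u v hu hv⟩⟩

/-- The map sending the class of a path to its pair of end points (target, source). -/
def anchor {X : Type*} [TopologicalSpace X] (a : PathClass X) : X × X := (a.target, a.source)

/-- The operation on path classes induced by the multiplication of `M`: the class of `a` and the
class of `b` are sent to the class of `t ↦ a t * b t`. -/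
noncomputable def mul {M : Type*} [TopologicalSpace M] [Mul M] [ContinuousMul M] (a b : PathClass M) :
    PathClass M :=
  ⟨a.source * b.source, a.target * b.target,
    (Path.Homotopic.prod a.hom b.hom).map ⟨fun p : M × M => p.1 * p.2, continuous_mul⟩⟩

end PathClass

/-- The fundamental groupoid of `X`, with object set `X`; `b ∘ a` is the class of the path that
first runs through `a` and then through `b`. Composition, units and inverses are those of
`FundamentalGroupoid X`. -/
noncomputable def fundamentalGroupoidOver (X : Type*) [TopologicalSpace X] : GroupoidOver (PathClass X) X where
  src a := a.source
  tgt a := a.target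
  unit x := ⟨x, x, Path.Homotopic.Quotient.refl x⟩
  inverse a := ⟨a.target, a.source, a.hom.symm⟩
  comp b a h := ⟨a.source, b.target, a.hom.trans (b.hom.cast h.symm rfl)⟩
  src_comp _ _ _ := rfl
  tgt_comp _ _ _ := rfl
  comp_assoc := by
    rintro ⟨_, _, c⟩ ⟨_, _, b⟩ ⟨_, _, a⟩ h₁ h₂
    dsimp only at h₁ h₂
    subst h₁ h₂
    simp
  src_unit _ := rfl
  tgt_unit _ := rfl
  comp_unit a := by simp
  unit_comp a := by simp
  src_inverse _ := rfl
  tgt_inverse _ := rfl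
  inverse_comp a := by simp
  comp_inverse a := by simp

/-! Pointwise multiplication makes the path classes a topological group in the lifted topology, and
the end-point map to `M × M` is a continuous homomorphism onto it, open because `M` is locally
path-connected. Its kernel, the classes of loops at `1`, is discrete because `M` has a contractible
neighbourhood of `1`. An open surjective homomorphism with discrete kernel is a covering
(`isCoveringMap_anchor`).

Charts are pulled back along this local homeomorphism, so a continuous map into the arrows is smooth
as soon as its end points depend smoothly on the argument (`IsLocalDiffeomorph.contMDiff_of_comp`).
This settles multiplication, group inversion and units. Interchange then rewrites composition as `b
* (unit b.source)⁻¹ * a` (`comp_eq_mul`), and similarly the groupoid inverse, so their smoothness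
follows from that of the group operations. Second countability comes from `C(I, M)`, of which the
arrows are an open quotient; the Hausdorff property is inherited from `M × M` through the covering.
-/

namespace PathClass

/-! ### The lifted topology and the end-point map -/

section Lifted

open scoped unitInterval

variable {X : Type*} [TopologicalSpace X]

/-- The set of classes `u⁻¹ a v` with `u` a path in `U` starting at the source of `a` and `v` a path
in `V` starting at the target of `a`. -/
def basicNhd (a : PathClass X) (U V : Set X) : Set (PathClass X) :=
  {b | ∃ (x y : X) (u : Path a.source x) (v : Path a.target y), Set.range u ⊆ U ∧ Set.range v ⊆ V ∧
    b = ⟨x, y, (Path.Homotopic.Quotient.mk u).symm.trans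
      (a.hom.trans (Path.Homotopic.Quotient.mk v))⟩}

theorem isOpen_iff_basicNhd {W : Set (PathClass X)} :
    IsOpen W ↔ ∀ a ∈ W, ∃ U ∈ 𝓝 a.source, ∃ V ∈ 𝓝 a.target, basicNhd a U V ⊆ W := by
  refine forall₂_congr fun a _ => exists_congr fun U => and_congr_right fun _ =>
    exists_congr fun V => and_congr_right fun _ => ⟨?_, ?_⟩
  · rintro h _ ⟨x, y, u, v, hu, hv, rfl⟩
    exact h x y u v hu hv
  · intro h x y u v hu hv
    exact h ⟨x, y, u, v, hu, hv, rfl⟩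

theorem basicNhd_mono (a : PathClass X) {U U' V V' : Set X} (hU : U ⊆ U') (hV : V ⊆ V') :
    basicNhd a U V ⊆ basicNhd a U' V' := by
  rintro _ ⟨x, y, u, v, hu, hv, rfl⟩
  exact ⟨x, y, u, v, hu.trans hU, hv.trans hV, rfl⟩

theorem mem_basicNhd_self {a : PathClass X} {U V : Set X} (hU : a.source ∈ U) (hV : a.target ∈ V) :
    a ∈ basicNhd a U V :=
  ⟨a.source, a.target, Path.refl _, Path.refl _, by simpa, by simpa, by
    rw [← Path.Homotopic.Quotient.mk_symm, Path.refl_symm, Path.Homotopic.Quotient.mk_refl,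
      Path.Homotopic.Quotient.mk_refl]
    simp⟩

/-- Concatenating the connecting paths at each end keeps them in `U` and `V`. This is what makes
basic neighbourhoods of open sets open. -/
theorem basicNhd_subset_of_mem {a b : PathClass X} {U V : Set X} (hb : b ∈ basicNhd a U V) :
    basicNhd b U V ⊆ basicNhd a U V := by
  obtain ⟨x, y, u, v, hu, hv, rfl⟩ := hb
  rintro _ ⟨x', y', u', v', hu', hv', rfl⟩
  refine ⟨x', y', u.trans u', v.trans v', ?_, ?_, ?_⟩
  · rw [Path.trans_range]; exact Set.union_subset hu hu'
  · rw [Path.trans_range]; exact Set.union_subset hv hv'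
  · have h : (Path.Homotopic.Quotient.mk (u.trans u')).symm =
        (Path.Homotopic.Quotient.mk u').symm.trans (Path.Homotopic.Quotient.mk u).symm := by
      rw [← Path.Homotopic.Quotient.mk_symm, Path.trans_symm]
      rfl
    rw [h]
    simp only [Path.Homotopic.Quotient.mk_trans, Path.Homotopic.Quotient.trans_assoc]

theorem source_target_mem_of_mem_basicNhd {a b : PathClass X} {U V : Set X}
    (hb : b ∈ basicNhd a U V) : b.source ∈ U ∧ b.target ∈ V := by
  obtain ⟨x, y, u, v, hu, hv, rfl⟩ := hb
  exact ⟨hu ⟨1, u.target⟩, hv ⟨1, v.target⟩⟩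

theorem isOpen_basicNhd (a : PathClass X) {U V : Set X} (hU : IsOpen U) (hV : IsOpen V) :
    IsOpen (basicNhd a U V) := by
  rw [isOpen_iff_basicNhd]
  intro b hb
  obtain ⟨h₁, h₂⟩ := source_target_mem_of_mem_basicNhd hb
  exact ⟨U, hU.mem_nhds h₁, V, hV.mem_nhds h₂, basicNhd_subset_of_mem hb⟩

theorem mem_nhds_iff_basicNhd {a : PathClass X} {W : Set (PathClass X)} :
    W ∈ 𝓝 a ↔ ∃ U ∈ 𝓝 a.source, ∃ V ∈ 𝓝 a.target, basicNhd a U V ⊆ W := by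
  constructor
  · intro h
    obtain ⟨W', hW', ho, ha⟩ := mem_nhds_iff.1 h
    obtain ⟨U, hU, V, hV, hs⟩ := isOpen_iff_basicNhd.1 ho a ha
    exact ⟨U, hU, V, hV, hs.trans hW'⟩
  · rintro ⟨U, hU, V, hV, hs⟩
    obtain ⟨U', hUU', hU', haU⟩ := mem_nhds_iff.1 hU
    obtain ⟨V', hVV', hV', haV⟩ := mem_nhds_iff.1 hV
    exact Filter.mem_of_superset
      ((isOpen_basicNhd a hU' hV').mem_nhds (mem_basicNhd_self haU haV))
      ((basicNhd_mono a hUU' hVV').trans hs)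

theorem basicNhd_mem_nhds {a : PathClass X} {U V : Set X} (hU : U ∈ 𝓝 a.source)
    (hV : V ∈ 𝓝 a.target) : basicNhd a U V ∈ 𝓝 a :=
  mem_nhds_iff_basicNhd.2 ⟨U, hU, V, hV, subset_rfl⟩

theorem continuous_anchor : Continuous (anchor : PathClass X → X × X) := by
  refine continuous_iff_continuousAt.2 fun a => ?_
  refine ContinuousAt.prodMk ?_ ?_
  · intro V hV
    refine Filter.mem_map.2 ?_
    exact Filter.mem_of_superset (basicNhd_mem_nhds Filter.univ_mem hV)
      fun (b : PathClass X) hb => (source_target_mem_of_mem_basicNhd hb).2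
  · intro U hU
    refine Filter.mem_map.2 ?_
    exact Filter.mem_of_superset (basicNhd_mem_nhds hU Filter.univ_mem)
      fun (b : PathClass X) hb => (source_target_mem_of_mem_basicNhd hb).1

theorem surjective_anchor [PathConnectedSpace X] :
    Function.Surjective (anchor : PathClass X → X × X) := fun p =>
  ⟨⟨p.2, p.1, .mk (PathConnectedSpace.somePath p.2 p.1)⟩, rfl⟩

/-- In a locally path-connected space, nearby points are joined by paths in a given
neighbourhood. -/
theorem exists_mem_nhds_forall_path [LocallyPathConnectedSpace X] {x : X} {U : Set X}
    (hU : U ∈ 𝓝 x) : ∃ V ∈ 𝓝 x, ∀ y ∈ V, ∃ p : Path x y, Set.range p ⊆ U := by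
  obtain ⟨V, ⟨hV, hVc⟩, hVU⟩ := (path_connected_basis x).mem_iff.1 hU
  refine ⟨V, hV, fun y hy => ?_⟩
  obtain ⟨p, hp⟩ := hVc.joinedIn x (mem_of_mem_nhds hV) y hy
  exact ⟨p, (Set.range_subset_iff.2 hp).trans hVU⟩

/-- End points close to those of `a` are reached by short paths, and prolonging `a` by these gives a
nearby class. -/
theorem isOpenMap_anchor [LocallyPathConnectedSpace X] :
    IsOpenMap (anchor : PathClass X → X × X) := by
  refine isOpenMap_iff_nhds_le.2 fun a W hW => ?_
  obtain ⟨U, hU, V, hV, h⟩ := mem_nhds_iff_basicNhd.1 (Filter.mem_map.1 hW)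
  obtain ⟨U', hU', hpU⟩ := exists_mem_nhds_forall_path hU
  obtain ⟨V', hV', hpV⟩ := exists_mem_nhds_forall_path hV
  refine Filter.mem_of_superset (prod_mem_nhds hV' hU') ?_
  rintro ⟨y, x⟩ ⟨hy, hx⟩
  obtain ⟨u, hu⟩ := hpU x hx
  obtain ⟨v, hv⟩ := hpV y hy
  exact h ⟨x, y, u, v, hu, hv, rfl⟩

/-- The class of a path given as a continuous map on the unit interval. -/
noncomputable def ofMap (f : C(I, X)) : PathClass X := ⟨f 0, f 1, .mk ⟨f, rfl, rfl⟩⟩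

theorem ofMap_path {x y : X} (p : Path x y) : ofMap (p : C(I, X)) = ⟨x, y, .mk p⟩ := by
  obtain ⟨f, rfl, rfl⟩ := p
  rfl

theorem surjective_ofMap : Function.Surjective (ofMap : C(I, X) → PathClass X) := by
  rintro ⟨x, y, p⟩
  induction p using Path.Homotopic.Quotient.ind with
  | mk p => exact ⟨p, ofMap_path p⟩

end Lifted

end PathClass

/-! ### Local contractibility and homotopy of short paths -/

theorem ChartedSpace.stronglyLocallyContractibleSpace {H M : Type*} [TopologicalSpace H]
    [StronglyLocallyContractibleSpace H] [TopologicalSpace M] [ChartedSpace H M] :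
    StronglyLocallyContractibleSpace M where
  contractible_basis x := by
    refine Filter.hasBasis_self.2 fun U hU => ?_
    have hsrc : (chartAt H x).source ∈ 𝓝 x := chart_source_mem_nhds H x
    have : StronglyLocallyContractibleSpace (chartAt H x).source := by
      have he := (chartAt H x).toHomeomorphSourceTarget.isOpenEmbedding
      have := (chartAt H x).open_target.stronglyLocallyContractibleSpace
      exact he.stronglyLocallyContractibleSpace
    have hU' : (Subtype.val : (chartAt H x).source → M) ⁻¹' U ∈ 𝓝 ⟨x, mem_chart_source H x⟩ :=
      continuous_subtype_val.continuousAt.preimage_mem_nhds hU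
    obtain ⟨t, ⟨ht, htc⟩, htU⟩ := (contractible_basis _).mem_iff.1 hU'
    refine ⟨Subtype.val '' t,
      (chartAt H x).open_source.isOpenEmbedding_subtypeVal.image_mem_nhds.2 ht, ?_,
      Set.image_subset_iff.2 htU⟩
    exact (Topology.IsEmbedding.subtypeVal.homeomorphImage t).symm.contractibleSpace

theorem NormedSpace.stronglyLocallyContractibleSpace {E : Type*} [NormedAddCommGroup E]
    [NormedSpace ℝ E] : StronglyLocallyContractibleSpace E :=
  .of_bases (fun x => Metric.nhds_basis_ball (x := x)) fun x r hr =>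
    (convex_ball x r).contractibleSpace ⟨x, Metric.mem_ball_self hr⟩

/-- Two paths in a simply connected subset with the same end points are homotopic in the ambient
space. -/
theorem Path.homotopic_of_range_subset {X : Type*} [TopologicalSpace X] {T : Set X}
    [SimplyConnectedSpace T] {x y : X} (p q : Path x y) (hp : Set.range p ⊆ T)
    (hq : Set.range q ⊆ T) : p.Homotopic q := by
  have hx : x ∈ T := hp ⟨0, p.source⟩
  have hy : y ∈ T := hp ⟨1, p.target⟩
  rw [Set.range_subset_iff] at hp hq
  let p' : Path (⟨x, hx⟩ : T) ⟨y, hy⟩ :=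
    ⟨⟨fun t => ⟨p t, hp t⟩, by fun_prop⟩, by simp, by simp⟩
  let q' : Path (⟨x, hx⟩ : T) ⟨y, hy⟩ :=
    ⟨⟨fun t => ⟨q t, hq t⟩, by fun_prop⟩, by simp, by simp⟩
  exact (SimplyConnectedSpace.paths_homotopic p' q').map ⟨Subtype.val, continuous_subtype_val⟩

/-! ### Smooth structure pulled back along a local homeomorphism -/

section PullbackCharts

variable {H X N : Type*} [TopologicalSpace H] [TopologicalSpace X] [TopologicalSpace N]
  [ChartedSpace H N] {f : X → N}

/-- The charts on the source of a local homeomorphism obtained by composing its local restrictions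
with charts of the target. -/
@[reducible]
noncomputable def IsLocalHomeomorph.pullbackChartedSpace (hf : IsLocalHomeomorph f) :
    ChartedSpace H X where
  atlas := Set.range fun x => (hf.localInverseAt x).symm.trans (chartAt H (f x))
  chartAt x := (hf.localInverseAt x).symm.trans (chartAt H (f x))
  mem_chart_source x := by simp
  chart_mem_atlas x := ⟨x, rfl⟩

/-- The local restrictions `e` and `e'` are both given by `f`, so `e' ∘ e⁻¹` is the identity where
defined, and a transition map upstairs is a restriction of a transition map of `N`. -/
theorem IsLocalHomeomorph.pullbackChartedSpace_hasGroupoid (hf : IsLocalHomeomorph f)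
    (G : StructureGroupoid H) [ClosedUnderRestriction G] [HasGroupoid N G] :
    letI := hf.pullbackChartedSpace (H := H)
    HasGroupoid X G := by
  let := hf.pullbackChartedSpace (H := H)
  refine ⟨?_⟩
  rintro _ _ ⟨x, rfl⟩ ⟨y, rfl⟩
  set e := (hf.localInverseAt x).symm with he
  set e' := (hf.localInverseAt y).symm with he'
  set c := chartAt H (f x)
  set c' := chartAt H (f y)
  have hcc := G.compatible (chart_mem_atlas H (f x)) (chart_mem_atlas H (f y))
  set T := (e.trans c).symm.trans (e'.trans c')
  refine G.mem_of_eqOnSource (closedUnderRestriction' hcc T.open_source) ?_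
  have hT : ∀ z ∈ T.source, e' (e.symm (c.symm z)) = c.symm z := by
    intro z hz
    have h : c.symm z ∈ e.target := by
      simp only [T, mfld_simps] at hz; exact hz.1.2
    have h1 : ∀ w, e' w = f w := fun w => by rw [he']; simp
    have h2 : ∀ w, e w = f w := fun w => by rw [he]; simp
    rw [h1, ← h2, e.right_inv h]
  refine ⟨?_, fun z hz => ?_⟩
  · rw [OpenPartialHomeomorph.restr_source' _ _ T.open_source]
    refine (Set.inter_eq_right.2 fun z hz => ?_).symm
    have := hT z hz
    simp only [T, mfld_simps] at hz ⊢
    rw [this] at hz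
    exact ⟨hz.1.1, hz.2.2⟩
  · have := hT z hz
    simp only [T, mfld_simps]
    rw [this]

end PullbackCharts

section PullbackSmooth

variable {E H X N : Type*} [NormedAddCommGroup E] [NormedSpace ℝ E] [TopologicalSpace H]
  [TopologicalSpace X] [TopologicalSpace N] {f : X → N}

theorem IsLocalHomeomorph.pullbackChartedSpace_isManifold [ChartedSpace H N]
    (hf : IsLocalHomeomorph f) (J : ModelWithCorners ℝ E H) [IsManifold J ∞ N] :
    letI := hf.pullbackChartedSpace (H := H)
    IsManifold J ∞ X := by
  let := hf.pullbackChartedSpace (H := H)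
  have : HasGroupoid X (contDiffGroupoid ∞ J) := hf.pullbackChartedSpace_hasGroupoid _
  exact IsManifold.mk' J ∞ X

theorem IsLocalHomeomorph.isLocalDiffeomorph_pullback [ChartedSpace H N]
    (hf : IsLocalHomeomorph f) (J : ModelWithCorners ℝ E H) [IsManifold J ∞ N] :
    letI := hf.pullbackChartedSpace (H := H)
    IsLocalDiffeomorph J J ∞ f := by
  let := hf.pullbackChartedSpace (H := H)
  have := hf.pullbackChartedSpace_isManifold J
  intro x
  set φ := (chartAt H x : OpenPartialHomeomorph X H) with hφ
  set c := chartAt H (f x) with hc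
  have hφe : φ = (hf.localInverseAt x).symm.trans c := rfl
  have hφs : ∀ w, φ w = c (f w) := fun w => by rw [hφe]; simp
  have hsub : φ.target ⊆ c.target := by
    rw [hφe]; intro z hz; simp only [mfld_simps] at hz; exact hz.1
  have hsrc : ∀ w ∈ φ.source, f w ∈ c.source := by
    rw [hφe]; intro z hz; simp only [mfld_simps] at hz; simpa using hz.2
  have h₁ : ContMDiffOn J J ∞ φ φ.source := contMDiffOn_chart
  have h₂ : ContMDiffOn J J ∞ φ.symm φ.target := contMDiffOn_chart_symm
  have h₃ : ContMDiffOn J J ∞ c c.source := contMDiffOn_chart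
  have h₄ : ContMDiffOn J J ∞ c.symm c.target := contMDiffOn_chart_symm
  -- Since `φ` is `c ∘ f`, the composite `c⁻¹ ∘ φ` is `f` itself near `x`, now a composite of charts
  -- smooth in both directions.
  let Φ := φ.trans c.symm
  refine ⟨⟨Φ.toPartialEquiv, Φ.open_source, Φ.open_target, ?_, ?_⟩, ?_, ?_⟩
  · exact h₄.comp (h₁.mono fun z hz => by simp only [Φ, mfld_simps] at hz; exact hz.1)
      fun z hz => by simp only [Φ, mfld_simps] at hz; exact hz.2
  · exact h₂.comp (h₃.mono fun z hz => by simp only [Φ, mfld_simps] at hz; exact hz.1)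
      fun z hz => by simp only [Φ, mfld_simps] at hz; exact hz.2
  · change x ∈ Φ.source
    simp only [Φ, mfld_simps]
    exact ⟨mem_chart_source H x, hsub (φ.map_source (mem_chart_source H x))⟩
  · intro z hz
    change z ∈ Φ.source at hz
    change f z = c.symm (φ z)
    simp only [Φ, mfld_simps] at hz
    rw [hφs, c.left_inv (hsrc z hz.1)]

/-- A continuous map is smooth if its composition with a local diffeomorphism is smooth. -/
theorem IsLocalDiffeomorph.contMDiff_of_comp {E' H' E'' H'' Y : Type*} [ChartedSpace H X]
    [NormedAddCommGroup E'] [NormedSpace ℝ E'] [TopologicalSpace H'] [ChartedSpace H' N]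
    [NormedAddCommGroup E''] [NormedSpace ℝ E''] [TopologicalSpace H''] [TopologicalSpace Y]
    [ChartedSpace H'' Y] {J : ModelWithCorners ℝ E H} {J' : ModelWithCorners ℝ E' H'}
    {K : ModelWithCorners ℝ E'' H''} (hf : IsLocalDiffeomorph J J' ∞ f) {g : Y → X}
    (hg : Continuous g) (hfg : ContMDiff K J' ∞ (f ∘ g)) : ContMDiff K J ∞ g := by
  intro y
  have h := (hf (g y)).localInverse_contMDiffAt.comp y (hfg y)
  refine h.congr_of_eventuallyEq ?_
  filter_upwards [hg.continuousAt.eventually (hf (g y)).localInverse_eventuallyEq_left] with z hz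
  exact hz.symm

/-- In pulled-back charts `f` reads as the identity; over a product its components therefore read as
linear projections, which gives the submersions below. -/
theorem IsLocalHomeomorph.extend_apply_pullback [ChartedSpace H N] (hf : IsLocalHomeomorph f)
    (J : ModelWithCorners ℝ E H) (x : X) {z : E} :
    letI := hf.pullbackChartedSpace (H := H)
    z ∈ ((chartAt H x).extend J).target →
      (chartAt H (f x)).extend J (f (((chartAt H x).extend J).symm z)) = z := by
  let := hf.pullbackChartedSpace (H := H)
  intro hz
  have h := ((chartAt H x).extend J).right_inv hz
  have hφ : ∀ w, chartAt H x w = chartAt H (f x) (f w) := fun w => by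
    change (hf.localInverseAt x).symm.trans (chartAt H (f x)) w = _
    simp
  simpa [hφ] using h

variable {E' H' A B : Type*} [TopologicalSpace H'] [NormedAddCommGroup E'] [NormedSpace ℝ E']
  [TopologicalSpace A] [TopologicalSpace B] [ChartedSpace H A] [ChartedSpace H' B]

theorem IsLocalHomeomorph.isSubmersion_fst_pullback {f : X → A × B} (hf : IsLocalHomeomorph f)
    (J : ModelWithCorners ℝ E H) (J' : ModelWithCorners ℝ E' H') [IsManifold J ∞ A]
    [IsManifold J' ∞ B] :
    letI := hf.pullbackChartedSpace (H := ModelProd H H')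
    Manifold.IsSubmersion (J.prod J') J ∞ fun x => (f x).1 := by
  let := hf.pullbackChartedSpace (H := ModelProd H H')
  have := hf.pullbackChartedSpace_isManifold (J.prod J')
  refine Manifold.IsSubmersionOfComplement.isSubmersion (F := E') fun x => ?_
  refine .mk_of_continuousAt hf.continuous.fst.continuousAt (.refl ℝ (E × E'))
    (chartAt (ModelProd H H') x) (chartAt H (f x).1) (mem_chart_source _ x) (mem_chart_source _ _)
    (IsManifold.chart_mem_maximalAtlas x) (IsManifold.chart_mem_maximalAtlas _) ?_
  intro z hz
  exact congrArg Prod.fst (hf.extend_apply_pullback (J.prod J') x hz)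

theorem IsLocalHomeomorph.isSubmersion_snd_pullback {f : X → A × B} (hf : IsLocalHomeomorph f)
    (J : ModelWithCorners ℝ E H) (J' : ModelWithCorners ℝ E' H') [IsManifold J ∞ A]
    [IsManifold J' ∞ B] :
    letI := hf.pullbackChartedSpace (H := ModelProd H H')
    Manifold.IsSubmersion (J.prod J') J' ∞ fun x => (f x).2 := by
  let := hf.pullbackChartedSpace (H := ModelProd H H')
  have := hf.pullbackChartedSpace_isManifold (J.prod J')
  refine Manifold.IsSubmersionOfComplement.isSubmersion (F := E) fun x => ?_
  refine .mk_of_continuousAt hf.continuous.snd.continuousAt (.prodComm ℝ E E')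
    (chartAt (ModelProd H H') x) (chartAt H' (f x).2) (mem_chart_source _ x) (mem_chart_source _ _)
    (IsManifold.chart_mem_maximalAtlas x) (IsManifold.chart_mem_maximalAtlas _) ?_
  intro z hz
  exact congrArg Prod.snd (hf.extend_apply_pullback (J.prod J') x hz)

end PullbackSmooth

/-! ### Pointwise products of homotopy classes -/

namespace Path.Homotopic.Quotient

variable {M : Type*} [TopologicalSpace M] [Mul M] [ContinuousMul M]

theorem map_trans {X Y : Type*} [TopologicalSpace X] [TopologicalSpace Y] {x y z : X}
    (p : Path.Homotopic.Quotient x y) (q : Path.Homotopic.Quotient y z) (f : C(X, Y)) :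
    (p.trans q).map f = (p.map f).trans (q.map f) := by
  induction p using Path.Homotopic.Quotient.ind
  induction q using Path.Homotopic.Quotient.ind
  exact congrArg Path.Homotopic.Quotient.mk (Path.map_trans _ _ f.continuous)

/-- The class of the pointwise product of two paths. -/
noncomputable def mul {x y x' y' : M} (p : Path.Homotopic.Quotient x y)
    (q : Path.Homotopic.Quotient x' y') : Path.Homotopic.Quotient (x * x') (y * y') :=
  (Path.Homotopic.prod p q).map ⟨fun p : M × M => p.1 * p.2, continuous_mul⟩

/-- Pairing paths commutes with concatenation, and so does mapping along the multiplication. This is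
the source of the interchange law. -/
theorem mul_trans {x y z x' y' z' : M} (p : Path.Homotopic.Quotient x y)
    (q : Path.Homotopic.Quotient y z) (p' : Path.Homotopic.Quotient x' y')
    (q' : Path.Homotopic.Quotient y' z') :
    (p.trans q).mul (p'.trans q') = (p.mul p').trans (q.mul q') := by
  rw [mul, ← Path.Homotopic.comp_prod_eq_prod_comp]
  exact map_trans _ _ _

theorem mul_symm {x y x' y' : M} (p : Path.Homotopic.Quotient x y)
    (p' : Path.Homotopic.Quotient x' y') : p.symm.mul p'.symm = (p.mul p').symm := by
  induction p using Path.Homotopic.Quotient.ind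
  induction p' using Path.Homotopic.Quotient.ind
  rfl

end Path.Homotopic.Quotient

instance ContinuousMap.isTopologicalGroup {X G : Type*} [TopologicalSpace X] [LocallyCompactSpace X]
    [TopologicalSpace G] [Group G] [IsTopologicalGroup G] : IsTopologicalGroup C(X, G) where
  continuous_mul := continuous_mul
  continuous_inv := ContinuousMap.continuous_postcomp ⟨fun x : G => x⁻¹, continuous_inv⟩

/-! ### The topological group of path classes -/

namespace PathClass

section Group

open scoped unitInterval

variable {M : Type*} [TopologicalSpace M] [Group M] [IsTopologicalGroup M]

/-- The group structure on path classes induced by the pointwise product of paths. -/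
noncomputable abbrev group : Group (PathClass M) where
  mul := PathClass.mul
  one := ⟨1, 1, .refl 1⟩
  inv a := ⟨a.source⁻¹, a.target⁻¹, a.hom.map ⟨fun x => x⁻¹, continuous_inv⟩⟩
  mul_assoc a b c := by
    obtain ⟨f, rfl⟩ := surjective_ofMap a
    obtain ⟨g, rfl⟩ := surjective_ofMap b
    obtain ⟨h, rfl⟩ := surjective_ofMap c
    exact congrArg ofMap (mul_assoc f g h)
  one_mul a := by
    obtain ⟨f, rfl⟩ := surjective_ofMap a
    exact congrArg ofMap (one_mul f)
  mul_one a := by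
    obtain ⟨f, rfl⟩ := surjective_ofMap a
    exact congrArg ofMap (mul_one f)
  inv_mul_cancel a := by
    obtain ⟨f, rfl⟩ := surjective_ofMap a
    exact congrArg ofMap (inv_mul_cancel f)

attribute [local instance] group

/-- `PathClass.ofMap` as a group homomorphism. -/
noncomputable def ofMapHom : C(I, M) →* PathClass M where
  toFun := ofMap
  map_one' := rfl
  map_mul' _ _ := rfl

/-- `PathClass.anchor` as a group homomorphism. -/
def anchorHom : PathClass M →* M × M where
  toFun := anchor
  map_one' := rfl
  map_mul' _ _ := rfl

/-- By interchange, `(u⁻¹ a v)(u'⁻¹ b v') = (uu')⁻¹ (ab) (vv')`, with pointwise products of paths.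
-/
theorem mul_mem_basicNhd {a b a' b' : PathClass M} {U V U' V' : Set M}
    (ha : a' ∈ basicNhd a U V) (hb : b' ∈ basicNhd b U' V') {U'' V'' : Set M}
    (hU : ∀ x ∈ U, ∀ y ∈ U', x * y ∈ U'') (hV : ∀ x ∈ V, ∀ y ∈ V', x * y ∈ V'') :
    a' * b' ∈ basicNhd (a * b) U'' V'' := by
  obtain ⟨x, y, u, v, hu, hv, rfl⟩ := ha
  obtain ⟨x', y', u', v', hu', hv', rfl⟩ := hb
  refine ⟨x * x', y * y', u.mul u', v.mul v', ?_, ?_, ?_⟩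
  · rintro _ ⟨t, rfl⟩
    exact hU _ (hu ⟨t, rfl⟩) _ (hu' ⟨t, rfl⟩)
  · rintro _ ⟨t, rfl⟩
    exact hV _ (hv ⟨t, rfl⟩) _ (hv' ⟨t, rfl⟩)
  · change (⟨x * x', y * y', Path.Homotopic.Quotient.mul _ _⟩ : PathClass M) = _
    rw [Path.Homotopic.Quotient.mul_trans, Path.Homotopic.Quotient.mul_trans,
      Path.Homotopic.Quotient.mul_symm]
    rfl

theorem inv_mem_basicNhd {a a' : PathClass M} {U V : Set M} (ha : a' ∈ basicNhd a U V)
    {U' V' : Set M} (hU : ∀ x ∈ U, x⁻¹ ∈ U') (hV : ∀ x ∈ V, x⁻¹ ∈ V') :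
    a'⁻¹ ∈ basicNhd a⁻¹ U' V' := by
  obtain ⟨x, y, u, v, hu, hv, rfl⟩ := ha
  refine ⟨x⁻¹, y⁻¹, u.map continuous_inv, v.map continuous_inv, ?_, ?_, ?_⟩
  · rintro _ ⟨t, rfl⟩
    exact hU _ (hu ⟨t, rfl⟩)
  · rintro _ ⟨t, rfl⟩
    exact hV _ (hv ⟨t, rfl⟩)
  · change (⟨x⁻¹, y⁻¹, Path.Homotopic.Quotient.map _ ⟨fun x : M => x⁻¹, continuous_inv⟩⟩ :
      PathClass M) = _
    rw [Path.Homotopic.Quotient.map_trans, Path.Homotopic.Quotient.map_trans]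
    rfl

theorem isTopologicalGroup : IsTopologicalGroup (PathClass M) where
  continuous_mul := by
    refine continuous_iff_continuousAt.2 fun ⟨a, b⟩ W hW => ?_
    obtain ⟨U, hU, V, hV, h⟩ := mem_nhds_iff_basicNhd.1 hW
    have hU' := (continuous_mul.tendsto (a.source, b.source)) hU
    have hV' := (continuous_mul.tendsto (a.target, b.target)) hV
    rw [nhds_prod_eq, Filter.mem_map, Filter.mem_prod_iff] at hU' hV'
    obtain ⟨U₁, hU₁, U₂, hU₂, hUU⟩ := hU'
    obtain ⟨V₁, hV₁, V₂, hV₂, hVV⟩ := hV'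
    refine Filter.mem_map.2 <| Filter.mem_of_superset
      (prod_mem_nhds (basicNhd_mem_nhds hU₁ hV₁) (basicNhd_mem_nhds hU₂ hV₂)) ?_
    rintro ⟨a', b'⟩ ⟨ha, hb⟩
    exact h (mul_mem_basicNhd ha hb (fun x hx y hy => hUU (Set.mk_mem_prod hx hy))
      (fun x hx y hy => hVV (Set.mk_mem_prod hx hy)))
  continuous_inv := by
    refine continuous_iff_continuousAt.2 fun a W hW => ?_
    obtain ⟨U, hU, V, hV, h⟩ := mem_nhds_iff_basicNhd.1 hW
    exact Filter.mem_map.2 <| Filter.mem_of_superset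
      (basicNhd_mem_nhds (continuous_inv.tendsto a.source hU) (continuous_inv.tendsto a.target hV))
      fun b hb => h (inv_mem_basicNhd hb (fun _ hx => hx) (fun _ hx => hx))

attribute [local instance] isTopologicalGroup

/-- For a homomorphism of topological groups, continuity need only be checked at the constant path
`1`. -/
theorem continuous_ofMap [LocallyPathConnectedSpace M] :
    Continuous (ofMap : C(I, M) → PathClass M) := by
  refine continuous_of_continuousAt_one (ofMapHom (M := M)) fun W hW => ?_
  rw [map_one] at hW
  obtain ⟨U, hU, V, hV, h⟩ := mem_nhds_iff_basicNhd.1 hW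
  obtain ⟨T, hT, hpT⟩ := exists_mem_nhds_forall_path (Filter.inter_mem hU hV)
  have ho : {f : C(I, M) | Set.MapsTo f Set.univ (interior (T ∩ (U ∩ V)))} ∈ 𝓝 1 :=
    (ContinuousMap.isOpen_setOfPred_mapsTo isCompact_univ isOpen_interior).mem_nhds fun t _ =>
      mem_interior_iff_mem_nhds.2 (Filter.inter_mem hT (Filter.inter_mem hU hV))
  refine Filter.mem_map.2 <| Filter.mem_of_superset ho fun f hf => h ?_
  have hf' : ∀ t, f t ∈ T ∩ (U ∩ V) := fun t => interior_subset (hf (Set.mem_univ t))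
  obtain ⟨u, hu⟩ := hpT (f 0) (hf' 0).1
  -- A path `f` near the constant one need not start at `1`, so it is written as `u⁻¹ (u f)` with
  -- `u` a short path from `1` to `f 0`.
  refine ⟨f 0, f 1, u, u.trans ⟨f, rfl, rfl⟩, hu.trans Set.inter_subset_left, ?_, ?_⟩
  · rw [Path.trans_range]
    refine Set.union_subset (hu.trans Set.inter_subset_right) ?_
    rintro _ ⟨t, rfl⟩
    exact (hf' t).2.2
  · change ofMap f = ⟨f 0, f 1, (Path.Homotopic.Quotient.mk u).symm.trans
      ((Path.Homotopic.Quotient.refl 1).trans _)⟩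
    rw [Path.Homotopic.Quotient.mk_trans, Path.Homotopic.Quotient.refl_trans,
      ← Path.Homotopic.Quotient.trans_assoc]
    simp [ofMap]

/-- Again it suffices to look at `1`: a class `u⁻¹ v` with `u`, `v` small is represented by a path
of small range, which is close to the constant path. -/
theorem isOpenMap_ofMap : IsOpenMap (ofMap : C(I, M) → PathClass M) := by
  have h1 : 𝓝 (1 : PathClass M) ≤ Filter.map ofMap (𝓝 (1 : C(I, M))) := by
    intro W hW
    -- Maps whose range shrinks to `1` converge to the constant map in the compact-open topology.
    have hL : Filter.Tendsto id
        (Filter.comap (fun f : C(I, M) => Set.range f) (𝓝 (1 : M)).smallSets) (𝓝 1) := by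
      refine ContinuousMap.tendsto_nhds_compactOpen.2 fun K _ U hU hKU => ?_
      obtain rfl | ⟨t, ht⟩ := K.eq_empty_or_nonempty
      · exact Filter.Eventually.of_forall fun f => Set.mapsTo_empty f U
      · filter_upwards [Filter.preimage_mem_comap
          ((Filter.hasBasis_smallSets _).mem_of_mem (hU.mem_nhds (hKU ht)))] with f hf s _
        exact hf ⟨s, rfl⟩
    obtain ⟨S, hS, hSW⟩ := Filter.mem_comap.1 (hL (Filter.mem_map.1 hW))
    obtain ⟨O, hO, hOS⟩ := (Filter.hasBasis_smallSets _).mem_iff.1 hS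
    refine mem_nhds_iff_basicNhd.2 ⟨O, hO, O, hO, ?_⟩
    rintro _ ⟨x, y, u, v, hu, hv, rfl⟩
    have : ofMap (u.symm.trans v : C(I, M)) ∈ W := hSW (hOS (by
      change Set.range (u.symm.trans v) ⊆ O
      rw [Path.trans_range, Path.symm_range]
      exact Set.union_subset hu hv))
    rw [ofMap_path] at this
    convert this using 2
    change (Path.Homotopic.Quotient.mk u).symm.trans ((Path.Homotopic.Quotient.refl 1).trans _) = _
    rw [Path.Homotopic.Quotient.refl_trans]
    rfl
  exact (IsTopologicalGroup.isOpenMap_iff_nhds_one (f := ofMapHom (M := M))).2 h1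

theorem secondCountableTopology [LocallyPathConnectedSpace M] [SecondCountableTopology M] :
    SecondCountableTopology (PathClass M) :=
  (isOpenMap_ofMap.isQuotientMap continuous_ofMap surjective_ofMap).secondCountableTopology
    isOpenMap_ofMap

/-- If `u` and `v` are loops at `1` inside a contractible neighbourhood, they are homotopic in `M`,
so `u⁻¹ v` is trivial: a basic neighbourhood of `1` meets the kernel only in `1`. -/
theorem isDiscrete_ker_anchorHom [StronglyLocallyContractibleSpace M] :
    IsDiscrete ((anchorHom (M := M)).ker : Set (PathClass M)) := by
  suffices DiscreteTopology (anchorHom (M := M)).ker from ⟨this⟩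
  refine discreteTopology_of_isOpen_singleton_one ?_
  obtain ⟨T, ⟨hT, _⟩, -⟩ := (contractible_basis (1 : M)).mem_iff.1 Filter.univ_mem
  refine isOpen_singleton_iff_nhds_eq_pure _ |>.2 (le_antisymm ?_ (pure_le_nhds _))
  refine Filter.le_pure_iff.2 (mem_nhds_subtype _ _ _ |>.2
    ⟨_, basicNhd_mem_nhds (a := (1 : PathClass M)) hT hT, ?_⟩)
  rintro ⟨_, hb⟩ ⟨x, y, u, v, hu, hv, rfl⟩
  obtain ⟨rfl, rfl⟩ : y = 1 ∧ x = 1 := Prod.ext_iff.1 hb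
  refine Subtype.ext ?_
  change (⟨1, 1, (Path.Homotopic.Quotient.mk u).symm.trans
    ((Path.Homotopic.Quotient.refl 1).trans _)⟩ : PathClass M) = ⟨1, 1, _⟩
  rw [Path.Homotopic.Quotient.refl_trans,
    Path.Homotopic.Quotient.eq.2 (Path.homotopic_of_range_subset u v hu hv),
    Path.Homotopic.Quotient.symm_trans]

theorem isCoveringMap_anchor [StronglyLocallyContractibleSpace M] [PathConnectedSpace M] :
    IsCoveringMap (anchor : PathClass M → M × M) :=
  (Topology.IsQuotientMap.isQuotientCoveringMap_of_isDiscrete_ker_monoidHom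
    (f := anchorHom (M := M))
    (isOpenMap_anchor.isQuotientMap continuous_anchor surjective_anchor)
    isDiscrete_ker_anchorHom).isCoveringMap

/-- Classes with equal end points are separated by the sheets of the covering, all others by their
end points. -/
theorem t2Space [StronglyLocallyContractibleSpace M] [PathConnectedSpace M] [T2Space M] :
    T2Space (PathClass M) where
  t2 a b hab := by
    by_cases h : anchor a = anchor b
    · exact isCoveringMap_anchor.isSeparatedMap a b h hab
    · exact separated_by_continuous continuous_anchor h

theorem continuous_unit [LocallyPathConnectedSpace M] :
    Continuous (fundamentalGroupoidOver M).unit :=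
  continuous_ofMap.comp (ContinuousMap.continuous_const' (X := I) (Y := M))

theorem interchange (a b c d : PathClass M) (h₁ : b.source = a.target) (h₂ : d.source = c.target)
    (h : (b * d).source = (a * c).target) :
    (fundamentalGroupoidOver M).comp b a h₁ * (fundamentalGroupoidOver M).comp d c h₂ =
      (fundamentalGroupoidOver M).comp (b * d) (a * c) h := by
  obtain ⟨y, z, b⟩ := b
  obtain ⟨x, _, a⟩ := a
  obtain ⟨y', z', d⟩ := d
  obtain ⟨x', _, c⟩ := c
  dsimp only at h₁ h₂
  subst h₁ h₂
  change (⟨_, _, Path.Homotopic.Quotient.mul (a.trans (b.cast rfl rfl))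
    (c.trans (d.cast rfl rfl))⟩ : PathClass M) =
    ⟨_, _, (a.mul c).trans ((b.mul d).cast rfl rfl)⟩
  simp only [Path.Homotopic.Quotient.mul_trans, Path.Homotopic.Quotient.cast_rfl_rfl]

end Group

end PathClass

/-! ### Groupoid operations in terms of the group -/

namespace PathClass

variable {M : Type*} [TopologicalSpace M] [Group M] [IsTopologicalGroup M]

attribute [local instance] group

/-- With `u = unit b.source` and `c = u⁻¹ a`, which ends at `1`, interchange gives `b c = (b ∘ u)(1
∘ c) = (b 1) ∘ (u c) = b ∘ a`. -/
theorem comp_eq_mul (b a : PathClass M) (h : b.source = a.target) :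
    (fundamentalGroupoidOver M).comp b a h =
      b * ((fundamentalGroupoidOver M).unit b.source)⁻¹ * a := by
  set 𝓖 := fundamentalGroupoidOver M
  set c := (𝓖.unit b.source)⁻¹ * a with hc
  have hct : 𝓖.tgt c = 1 := by
    change b.source⁻¹ * a.target = 1
    rw [h, inv_mul_cancel]
  -- Stated for a variable `e` so that the unit can be replaced by `1` despite the dependent
  -- composability proof.
  have h1 : ∀ e, e = 𝓖.unit (𝓖.tgt c) → ∀ h, 𝓖.comp e c h = c := by
    rintro _ rfl _
    exact 𝓖.unit_comp c
  have huc : 𝓖.unit b.source * c = a := by rw [hc, mul_inv_cancel_left]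
  have h2 : (b * 1).source = (𝓖.unit b.source * c).target := by rw [mul_one, huc, h]
  have h3 : b * c = 𝓖.comp (b * 1) (𝓖.unit b.source * c) h2 :=
    (congrArg₂ (· * ·) (𝓖.comp_unit b) (h1 1 (by rw [hct]; rfl) hct.symm)).symm.trans
      (interchange (𝓖.unit b.source) b c 1 rfl hct.symm h2)
  simp only [mul_one, huc] at h3
  rw [← h3, hc, mul_assoc]

/-- Expand `a ∘ inverse a = unit a.target` by `comp_eq_mul` and solve in the group. -/
theorem inverse_eq_mul (a : PathClass M) :
    (fundamentalGroupoidOver M).inverse a =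
      (fundamentalGroupoidOver M).unit a.source * a⁻¹ *
        (fundamentalGroupoidOver M).unit a.target := by
  have h := ((comp_eq_mul a _ rfl).symm.trans ((fundamentalGroupoidOver M).comp_inverse a) :
    _ = (fundamentalGroupoidOver M).unit a.target)
  rw [← h]
  group

theorem compMap_eq_mul {p : PathClass M × PathClass M}
    (hp : p ∈ (fundamentalGroupoidOver M).composable) :
    (fundamentalGroupoidOver M).compMap p =
      p.1 * ((fundamentalGroupoidOver M).unit p.1.source)⁻¹ * p.2 := by
  exact (dif_pos hp).trans (comp_eq_mul _ _ hp)

theorem inv_comp (b a : PathClass M) (h : b.source = a.target) :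
    ((fundamentalGroupoidOver M).comp b a h)⁻¹ =
      (fundamentalGroupoidOver M).comp b⁻¹ a⁻¹ (congrArg (·⁻¹) h) := by
  obtain ⟨y, z, b⟩ := b
  obtain ⟨x, _, a⟩ := a
  dsimp only at h
  subst h
  change (⟨_, _, Path.Homotopic.Quotient.map (a.trans (b.cast rfl rfl))
    ⟨fun x : M => x⁻¹, continuous_inv⟩⟩ : PathClass M) =
    ⟨_, _, (a.map ⟨fun x : M => x⁻¹, continuous_inv⟩).trans
      ((b.map ⟨fun x : M => x⁻¹, continuous_inv⟩).cast rfl rfl)⟩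
  simp only [Path.Homotopic.Quotient.map_trans, Path.Homotopic.Quotient.cast_rfl_rfl]

end PathClass

/-! ### The Lie group-groupoid structure -/

theorem mainTheorem3 {E : Type*} [NormedAddCommGroup E] [NormedSpace ℝ E] [FiniteDimensional ℝ E]
    {M : Type*} [TopologicalSpace M] [T2Space M] [SecondCountableTopology M] [ConnectedSpace M]
    [Group M] [ChartedSpace E M] [LieGroup 𝓘(ℝ, E) ∞ M] :
    haveI : IsTopologicalGroup M := topologicalGroup_of_lieGroup 𝓘(ℝ, E) ∞
    ∃ (_ : ChartedSpace (ModelProd E E) (PathClass M)) (_ : Group (PathClass M)),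
      (∀ a b : PathClass M, a * b = PathClass.mul a b) ∧
      IsCoveringMap (PathClass.anchor : PathClass M → M × M) ∧
      IsLocalDiffeomorph (𝓘(ℝ, E).prod 𝓘(ℝ, E)) (𝓘(ℝ, E).prod 𝓘(ℝ, E)) ∞
        (PathClass.anchor : PathClass M → M × M) ∧
      IsLieGroupGroupoid (𝓘(ℝ, E).prod 𝓘(ℝ, E)) 𝓘(ℝ, E) (fundamentalGroupoidOver M) := by
  have : IsTopologicalGroup M := topologicalGroup_of_lieGroup 𝓘(ℝ, E) ∞
  have : StronglyLocallyContractibleSpace E := NormedSpace.stronglyLocallyContractibleSpace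
  have : StronglyLocallyContractibleSpace M :=
    ChartedSpace.stronglyLocallyContractibleSpace (H := E)
  have : PathConnectedSpace M := pathConnectedSpace_iff_connectedSpace.2 inferInstance
  let := PathClass.group (M := M)
  have := PathClass.isTopologicalGroup (M := M)
  have hcov := PathClass.isCoveringMap_anchor (M := M)
  have hloc := hcov.isLocalHomeomorph
  let charts := hloc.pullbackChartedSpace (H := ModelProd E E)
  have hman := hloc.pullbackChartedSpace_isManifold (𝓘(ℝ, E).prod 𝓘(ℝ, E))
  have hdiff := hloc.isLocalDiffeomorph_pullback (𝓘(ℝ, E).prod 𝓘(ℝ, E))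
  have hanchor := hdiff.contMDiff
  have htgt : ContMDiff (𝓘(ℝ, E).prod 𝓘(ℝ, E)) 𝓘(ℝ, E) ∞ (PathClass.target : PathClass M → M) :=
    contMDiff_fst.comp hanchor
  have hsrc : ContMDiff (𝓘(ℝ, E).prod 𝓘(ℝ, E)) 𝓘(ℝ, E) ∞ (PathClass.source : PathClass M → M) :=
    contMDiff_snd.comp hanchor
  have hmul : ContMDiff ((𝓘(ℝ, E).prod 𝓘(ℝ, E)).prod (𝓘(ℝ, E).prod 𝓘(ℝ, E)))
      (𝓘(ℝ, E).prod 𝓘(ℝ, E)) ∞ fun p : PathClass M × PathClass M => p.1 * p.2 :=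
    hdiff.contMDiff_of_comp continuous_mul <|
      ((htgt.comp contMDiff_fst).mul (htgt.comp contMDiff_snd)).prodMk
        ((hsrc.comp contMDiff_fst).mul (hsrc.comp contMDiff_snd))
  have hinv : ContMDiff (𝓘(ℝ, E).prod 𝓘(ℝ, E)) (𝓘(ℝ, E).prod 𝓘(ℝ, E)) ∞
      fun a : PathClass M => a⁻¹ :=
    hdiff.contMDiff_of_comp continuous_inv (htgt.inv.prodMk hsrc.inv)
  have hunit : ContMDiff 𝓘(ℝ, E) (𝓘(ℝ, E).prod 𝓘(ℝ, E)) ∞ (fundamentalGroupoidOver M).unit :=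
    hdiff.contMDiff_of_comp PathClass.continuous_unit (contMDiff_id.prodMk contMDiff_id)
  have hlie : LieGroup (𝓘(ℝ, E).prod 𝓘(ℝ, E)) ∞ (PathClass M) :=
    { hman with
      contMDiff_mul := hmul
      contMDiff_inv := hinv }
  have hT2 : T2Space (PathClass M) := PathClass.t2Space
  refine ⟨charts, PathClass.group, fun _ _ => rfl, hcov, hdiff, ?_⟩
  refine
    { isLieGroupoid :=
        { manifold := ⟨inferInstance, inferInstance, hman, PathClass.secondCountableTopology⟩
          manifold₀ := ⟨inferInstance, inferInstance, inferInstance, inferInstance⟩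
          t2₀ := inferInstance
          t2_fibre := fun _ => inferInstance
          src_surjective := fun x => ⟨_, (fundamentalGroupoidOver M).src_unit x⟩
          tgt_surjective := fun x => ⟨_, (fundamentalGroupoidOver M).tgt_unit x⟩
          src_submersion := hloc.isSubmersion_snd_pullback _ _
          tgt_submersion := hloc.isSubmersion_fst_pullback _ _
          contMDiffOn_comp := ?_
          contMDiff_unit := hunit
          contMDiff_inverse := ?_ }
      t2 := hT2
      lieGroup := hlie
      mul_morphism := ⟨fun _ => rfl, fun _ => rfl, ?_, hmul, contMDiff_mul _ _⟩
      one_morphism := ⟨fun _ => rfl, fun _ => rfl, ?_, contMDiff_const, contMDiff_const⟩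
      inv_morphism := ⟨fun _ => rfl, fun _ => rfl, ?_, hinv, contMDiff_inv _ _⟩
      one_eq_unit := rfl
      interchange := PathClass.interchange }
  -- The group formula for composition is smooth on all pairs of arrows, hence on the composable
  -- ones, where the two agree.
  · refine ContMDiff.contMDiffOn (s := (fundamentalGroupoidOver M).composable)
      (((contMDiff_fst (I := 𝓘(ℝ, E).prod 𝓘(ℝ, E)) (M := PathClass M)).mul
        (hunit.comp (hsrc.comp contMDiff_fst)).inv).mul contMDiff_snd) |>.congr ?_
    exact fun p hp => PathClass.compMap_eq_mul hp
  · exact (((hunit.comp hsrc).mul hinv).mul (hunit.comp htgt)).congr PathClass.inverse_eq_mul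
  · exact fun q p h => PathClass.interchange p.1 q.1 p.2 q.2 (congrArg Prod.fst h)
      (congrArg Prod.snd h) _
  · intro _ _ _
    exact ((fundamentalGroupoidOver M).comp_unit 1).symm
  · exact PathClass.inv_comp
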